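/- For an odd prime $n$, let $H(n)$ be the group of matrices $(x,y,z)=\begin{pmatrix}1&x&z\\0&1&y\\0&0&1\end{pmatrix}$ with $x,y,z\in\mathbb{Z}/n\mathbb{Z}$, under matrix multiplication. Let $r_1,s_1,r_2,s_2\in\mathbb{Z}/n\mathbb{Z}$ with $r_1s_2\not\equiv r_2s_1 \pmod n$, and let $S\subset H(n)$ be either the set $\{(s_1,r_1,0),(-s_1,-r_1,0),(s_2,r_2,0),(-s_2,-r_2,0)\}$ or the symmetric set $\{(s_1,r_1,0)^{\pm1},(s_2,r_2,0)^{\pm1}\}$. Let $P_k$ be the distribution after $k$ steps of the random walk on $H(n)$ that starts at the identity and at each step multiplies on the right by an independent, uniformly chosen element of $S$, let $U$ be the uniform distribution on $H(n)$, and let $\|P-Q\|_{TV}=\frac12\sum_{g\in H(n)}|P(g)-Q(g)|$. Then order $n^2$ steps are necessary and sufficient for the walk to become uniform: there are constants $a,b,B>0$, independent of $n,r_1,s_1,r_2,s_2,S$ and $k$, such that for all integers $k\ge0$ $$\tfrac12\,e^{-ak/n^2}\;\le\;\|P_k-U\|_{TV}\;\le\;B\,e^{-bk/n^2}.$$ 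-/

import Mathlib

/-- The Heisenberg group over `R`: the triple `(x, y, z)` stands for the upper unitriangular matrix
`!![1, x, z; 0, 1, y; 0, 0, 1]`. -/
@[ext]
structure Heisenberg (R : Type*) where
  x : R
  y : R
  z : R

namespace Heisenberg

/-- The matrix that a triple stands for. -/
def toMatrix {R : Type*} [CommRing R] (g : Heisenberg R) : Matrix (Fin 3) (Fin 3) R :=
  !![1, g.x, g.z; 0, 1, g.y; 0, 0, 1]

/-- Multiplication is matrix multiplication; see `toMatrix_mul`, `toMatrix_one` and
`toMatrix_injective`. -/
instance {R : Type*} [CommRing R] : Mul (Heisenberg R) where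
  mul g h := ⟨g.x + h.x, g.y + h.y, g.z + h.z + g.x * h.y⟩

instance {R : Type*} [CommRing R] : One (Heisenberg R) where
  one := ⟨0, 0, 0⟩

instance {R : Type*} [CommRing R] : Inv (Heisenberg R) where
  inv g := ⟨-g.x, -g.y, -g.z + g.x * g.y⟩

theorem mul_def {R : Type*} [CommRing R] (g h : Heisenberg R) :
    g * h = ⟨g.x + h.x, g.y + h.y, g.z + h.z + g.x * h.y⟩ := rfl

theorem one_def {R : Type*} [CommRing R] : (1 : Heisenberg R) = ⟨0, 0, 0⟩ := rfl

theorem inv_def {R : Type*} [CommRing R] (g : Heisenberg R) :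
    g⁻¹ = ⟨-g.x, -g.y, -g.z + g.x * g.y⟩ := rfl

instance {R : Type*} [CommRing R] : Group (Heisenberg R) where
  mul_assoc a b c := by ext <;> simp only [mul_def] <;> ring
  one_mul a := by ext <;> simp [mul_def, one_def]
  mul_one a := by ext <;> simp [mul_def, one_def]
  inv_mul_cancel a := by ext <;> simp [mul_def, one_def, inv_def]

theorem toMatrix_injective {R : Type*} [CommRing R] :
    Function.Injective (toMatrix : Heisenberg R → Matrix (Fin 3) (Fin 3) R) := by
  intro g h e
  ext
  · simpa [toMatrix] using congrFun (congrFun e 0) 1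
  · simpa [toMatrix] using congrFun (congrFun e 1) 2
  · simpa [toMatrix] using congrFun (congrFun e 0) 2

theorem toMatrix_one {R : Type*} [CommRing R] : toMatrix (1 : Heisenberg R) = 1 := by
  change toMatrix (mk 0 0 0) = 1
  ext i j
  fin_cases i <;> fin_cases j <;> simp [toMatrix]

theorem toMatrix_mul {R : Type*} [CommRing R] (g h : Heisenberg R) :
    toMatrix (g * h) = toMatrix g * toMatrix h := by
  change toMatrix (mk (g.x + h.x) (g.y + h.y) (g.z + h.z + g.x * h.y)) = _
  ext i j
  fin_cases i <;> fin_cases j <;> simp [toMatrix, Matrix.mul_apply, Fin.sum_univ_three] <;> ring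

/-- A group element as a triple of coordinates. -/
def equivProd (R : Type*) : Heisenberg R ≃ R × R × R where
  toFun g := (g.x, g.y, g.z)
  invFun t := ⟨t.1, t.2.1, t.2.2⟩
  left_inv _ := rfl
  right_inv _ := rfl

instance {R : Type*} [DecidableEq R] : DecidableEq (Heisenberg R) := (equivProd R).decidableEq

instance {R : Type*} [Fintype R] : Fintype (Heisenberg R) := Fintype.ofEquiv _ (equivProd R).symm

/-- The step set `{(s₁, r₁, 0), (-s₁, -r₁, 0), (s₂, r₂, 0), (-s₂, -r₂, 0)}`, the negatives being
taken coordinatewise. -/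
def negSteps {R : Type*} [CommRing R] [DecidableEq R] (r₁ s₁ r₂ s₂ : R) : Finset (Heisenberg R) :=
  {⟨s₁, r₁, 0⟩, ⟨-s₁, -r₁, 0⟩, ⟨s₂, r₂, 0⟩, ⟨-s₂, -r₂, 0⟩}

/-- The symmetric step set `{(s₁, r₁, 0)^±1, (s₂, r₂, 0)^±1}`, with inverses in the group. -/
def invSteps {R : Type*} [CommRing R] [DecidableEq R] (r₁ s₁ r₂ s₂ : R) : Finset (Heisenberg R) :=
  {⟨s₁, r₁, 0⟩, (⟨s₁, r₁, 0⟩ : Heisenberg R)⁻¹, ⟨s₂, r₂, 0⟩, (⟨s₂, r₂, 0⟩ : Heisenberg R)⁻¹}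

end Heisenberg

/-- The law after `k` steps of the random walk on a group that starts at the identity and at each
step multiplies on the right by an independent, uniformly chosen element of `S`. -/
noncomputable def walkLaw {H : Type*} [Group H] (S : Finset H) (hS : S.Nonempty) : ℕ → PMF H
  | 0 => PMF.pure 1
  | k + 1 => (walkLaw S hS k).bind fun g => (PMF.uniformOfFinset S hS).map fun s => g * s

/-- Total variation distance of two probability distributions on a finite set. -/
noncomputable def tvDist {α : Type*} [Fintype α] (p q : PMF α) : ℝ :=
  (1 / 2) * ∑ a, |(p a).toReal - (q a).toReal|

/-!
Fourier analysis on the Heisenberg group, frequency by frequency of its center. At a nontrivial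
central frequency the group acts by isometries, and its commutators act by scalars. A step over `v`
and a step over `-v` add up without cancellation only on vectors nearly fixed by their quotient `U`;
likewise for `±w` and a quotient `V`. As `U` and `V` commute up to a scalar `q ≠ 1`, no vector can
be nearly fixed by both, and since `‖q - 1‖` is at least of order `1 / n`, these frequencies are
damped after about `n log n` steps. The trivial central frequency is the projection of the walk to
the plane, with steps `±v`, `±w`. The change of coordinates `u ↦ (u ⬝ v, u ⬝ w)` of the frequencies
turns its Fourier sum into a product of two sums over a cycle, which needs `n ^ 2` steps to decay.
Conversely the frequency with coordinates `(0, 1)` has step average `cos (π / n) ^ 2`, and testing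
the uniform law against this one character gives the lower bound.
-/

section RealBounds

theorem exp_neg_two_mul_sq_le_cos {x : ℝ} (hx : x ^ 2 ≤ 3 / 2) :
    Real.exp (-(2 * x ^ 2)) ≤ Real.cos x := by
  refine le_trans ?_ (Real.one_sub_sq_div_two_le_cos (x := x))
  rw [Real.exp_neg, inv_le_iff_one_le_mul₀ (Real.exp_pos _)]
  calc 1 ≤ (1 - x ^ 2 / 2) * (2 * x ^ 2 + 1) := by nlinarith [sq_nonneg x]
    _ ≤ (1 - x ^ 2 / 2) * Real.exp (2 * x ^ 2) := by
        gcongr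
        · linarith
        · exact Real.add_one_le_exp _

theorem pow_three_mul_exp_neg_le {x k : ℝ} (hx : 1 ≤ x) (hk : x ^ 2 ≤ k) :
    x ^ 3 * Real.exp (-(k / (6 * x))) ≤ 10368 * Real.exp (-(k / (12 * x ^ 2))) := by
  have hk₀ : 0 ≤ k := (sq_nonneg x).trans hk
  have hsplit : Real.exp (-(k / (6 * x))) =
      Real.exp (-(k / (12 * x))) * Real.exp (-(k / (12 * x))) := by
    rw [← Real.exp_add]
    congr 1
    ring
  have hlinear : x / 12 ≤ k / (12 * x) := by
    rw [div_le_div_iff₀ (by positivity) (by positivity)]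
    linarith
  -- `10368 = 3! * 12 ^ 3`
  have htaylor : x ^ 3 ≤ 10368 * Real.exp (x / 12) := by
    have hcube := Real.pow_div_factorial_le_exp (x / 12) (by positivity) 3
    norm_num [Nat.factorial] at hcube
    linarith
  have hbounded : x ^ 3 * Real.exp (-(k / (12 * x))) ≤ 10368 := by
    rw [Real.exp_neg, mul_inv_le_iff₀ (Real.exp_pos _)]
    exact htaylor.trans (by gcongr)
  rw [hsplit, ← mul_assoc]
  gcongr
  nlinarith

end RealBounds

section AlmostCommutingIsometries

variable {𝕜 E : Type*} [RCLike 𝕜] [NormedAddCommGroup E] [InnerProductSpace 𝕜 E]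

theorem norm_inner_sub_map_le (T : E →ₗᵢ[𝕜] E) (f g : E) :
    ‖inner 𝕜 f (g - T g)‖ ≤ ‖f - T f‖ * ‖g‖ := by
  have h : inner 𝕜 f (g - T g) = inner 𝕜 (T f - f) (T g) := by
    rw [inner_sub_right, inner_sub_left, T.inner_map_map]
  rw [h, norm_sub_rev f, ← T.norm_map g]
  exact norm_inner_le_norm _ _

theorem norm_sub_one_mul_norm_inner_map_map_le (U V : E →ₗᵢ[𝕜] E) {q : 𝕜} {f : E}
    (h : U (V f) = q • V (U f)) :
    ‖q - 1‖ * ‖inner 𝕜 f (V (U f))‖ ≤ ‖f - U f‖ ^ 2 + ‖f - V f‖ ^ 2 := by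
  -- `(q - 1) V U = U V - V U` is the commutator of `1 - U` and `1 - V`.
  have commutator : (q - 1) * inner 𝕜 f (V (U f)) =
      inner 𝕜 f ((f - V f) - U (f - V f)) - inner 𝕜 f ((f - U f) - V (f - U f)) := by
    rw [← inner_smul_right, ← inner_sub_right, sub_smul, ← h, one_smul]
    congr 1
    simp only [map_sub]
    abel
  calc ‖q - 1‖ * ‖inner 𝕜 f (V (U f))‖
      ≤ ‖f - U f‖ * ‖f - V f‖ + ‖f - V f‖ * ‖f - U f‖ := by
        rw [← norm_mul, commutator]
        exact norm_sub_le_of_le (norm_inner_sub_map_le U f _) (norm_inner_sub_map_le V f _)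
    _ ≤ ‖f - U f‖ ^ 2 + ‖f - V f‖ ^ 2 := by
        linarith [two_mul_le_add_sq ‖f - U f‖ ‖f - V f‖]

theorem norm_sq_sub_le_norm_inner_map_map (U V : E →ₗᵢ[𝕜] E) (f : E) :
    ‖f‖ ^ 2 - (‖f - U f‖ ^ 2 + ‖f - V f‖ ^ 2) ≤ ‖inner 𝕜 f (V (U f))‖ := by
  have hdist : ‖f - V (U f)‖ ≤ ‖f - V f‖ + ‖f - U f‖ := by
    rw [← V.norm_map (f - U f), map_sub]
    exact norm_sub_le_norm_sub_add_norm_sub _ _ _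
  have hsq : ‖f - V (U f)‖ ^ 2 ≤ 2 * (‖f - V f‖ ^ 2 + ‖f - U f‖ ^ 2) :=
    (pow_le_pow_left₀ (norm_nonneg _) hdist 2).trans add_sq_le
  have hexpand := norm_sub_sq (𝕜 := 𝕜) f (V (U f))
  rw [V.norm_map, U.norm_map] at hexpand
  linarith [RCLike.re_le_norm (inner 𝕜 f (V (U f)))]

/-- An uncertainty principle. Bounding the commutator by the triangle inequality alone would only
give a bound with `‖q - 1‖ ^ 2` on the left. -/
theorem norm_sub_one_mul_norm_sq_le (U V : E →ₗᵢ[𝕜] E) {q : 𝕜} {f : E}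
    (h : U (V f) = q • V (U f)) :
    ‖q - 1‖ * ‖f‖ ^ 2 ≤ (1 + ‖q - 1‖) * (‖f - U f‖ ^ 2 + ‖f - V f‖ ^ 2) := by
  have hinner := mul_le_mul_of_nonneg_left (norm_sq_sub_le_norm_inner_map_map U V f)
    (norm_nonneg (q - 1))
  linarith [norm_sub_one_mul_norm_inner_map_map_le U V h]

theorem norm_sub_one_le_two {q : 𝕜} (hq : ‖q‖ = 1) : ‖q - 1‖ ≤ 2 := by
  calc ‖q - 1‖ ≤ ‖q‖ + ‖(1 : 𝕜)‖ := norm_sub_le _ _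
    _ = 2 := by rw [hq, norm_one, one_add_one_eq_two]

theorem norm_sum_isometries_le (A A' B B' U V : E →ₗᵢ[𝕜] E) {q : 𝕜} (hq : ‖q‖ = 1) {f : E}
    (hA : A f = A' (U f)) (hB : B f = B' (V f)) (h : U (V f) = q • V (U f)) :
    ‖A f + A' f + (B f + B' f)‖ ≤ (4 - ‖q - 1‖ / 12) * ‖f‖ := by
  have hq2 := norm_sub_one_le_two hq
  have parallelogram (T W : E →ₗᵢ[𝕜] E) :
      ‖T (W f) + T f‖ ^ 2 = 4 * ‖f‖ ^ 2 - ‖f - W f‖ ^ 2 := by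
    have hlaw := parallelogram_law_with_norm 𝕜 f (W f)
    rw [W.norm_map] at hlaw
    rw [← map_add, T.norm_map, add_comm]
    linarith
  have hsum : ‖A f + A' f + (B f + B' f)‖ ^ 2 ≤ 2 * (‖A f + A' f‖ ^ 2 + ‖B f + B' f‖ ^ 2) :=
    (pow_le_pow_left₀ (norm_nonneg _) (norm_add_le _ _) 2).trans add_sq_le
  rw [hA, hB, parallelogram A' U, parallelogram B' V, ← hA, ← hB] at hsum
  have hdefect : ‖q - 1‖ * ‖f‖ ^ 2 ≤ 3 * (‖f - U f‖ ^ 2 + ‖f - V f‖ ^ 2) :=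
    (norm_sub_one_mul_norm_sq_le U V h).trans (by gcongr; linarith)
  refine le_of_sq_le_sq ?_ (mul_nonneg (by linarith) (norm_nonneg f))
  calc ‖A f + A' f + (B f + B' f)‖ ^ 2 ≤ (16 - 2 * ‖q - 1‖ / 3) * ‖f‖ ^ 2 := by linarith
    _ ≤ ((4 - ‖q - 1‖ / 12) * ‖f‖) ^ 2 := by
        rw [mul_pow]
        gcongr
        linarith [sq_nonneg (‖q - 1‖ / 12)]

end AlmostCommutingIsometries

section AdditiveCharacters

variable {R : Type*} [CommRing R] [Fintype R] {ψ : AddChar R ℂ}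

theorem sum_norm_sq_sum_mul_addChar (hψ : ψ.IsPrimitive) (f : R → ℂ) :
    ∑ m, ‖∑ z, f z * ψ (m * z)‖ ^ 2 = Fintype.card R * ∑ z, ‖f z‖ ^ 2 := by
  classical
  have orthogonality (z w : R) : ∑ m, f z * ψ (m * z) * (starRingEnd ℂ) (f w * ψ (m * w)) =
      if z = w then Fintype.card R * (f z * (starRingEnd ℂ) (f z)) else 0 := by
    have hterm (m : R) : f z * ψ (m * z) * (starRingEnd ℂ) (f w * ψ (m * w)) =
        f z * (starRingEnd ℂ) (f w) * ψ (m * (z - w)) := by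
      rw [map_mul (starRingEnd ℂ), ← AddChar.map_neg_eq_conj, mul_sub, sub_eq_add_neg,
        AddChar.map_add_eq_mul]
      ring
    simp_rw [hterm, ← Finset.mul_sum, AddChar.sum_mulShift _ hψ, sub_eq_zero]
    split_ifs with hzw
    · rw [hzw, mul_comm]
    · rw [Nat.cast_zero, mul_zero]
  have hcomplex : ∑ m, (∑ z, f z * ψ (m * z)) * (starRingEnd ℂ) (∑ z, f z * ψ (m * z)) =
      Fintype.card R * ∑ z, f z * (starRingEnd ℂ) (f z) := by
    simp_rw [map_sum, Finset.sum_mul_sum]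
    rw [Finset.sum_comm, Finset.mul_sum]
    refine Finset.sum_congr rfl fun z _ => ?_
    rw [Finset.sum_comm]
    simp_rw [orthogonality, Finset.sum_ite_eq, Finset.mem_univ, if_true]
  simp_rw [Complex.mul_conj'] at hcomplex
  exact_mod_cast hcomplex

theorem sum_norm_sq_sum_prod_mul_addChar (hψ : ψ.IsPrimitive) (f : R × R → ℂ) :
    ∑ w : R × R, ‖∑ v : R × R, f v * ψ (w.1 * v.1 + w.2 * v.2)‖ ^ 2 =
      Fintype.card R ^ 2 * ∑ v, ‖f v‖ ^ 2 := by
  have iterated (w : R × R) : ∑ v : R × R, f v * ψ (w.1 * v.1 + w.2 * v.2) =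
      ∑ x, (∑ y, f (x, y) * ψ (w.2 * y)) * ψ (w.1 * x) := by
    rw [Fintype.sum_prod_type]
    refine Finset.sum_congr rfl fun x _ => ?_
    rw [Finset.sum_mul]
    refine Finset.sum_congr rfl fun y _ => ?_
    rw [AddChar.map_add_eq_mul]
    ring
  calc ∑ w : R × R, ‖∑ v : R × R, f v * ψ (w.1 * v.1 + w.2 * v.2)‖ ^ 2
      = ∑ b, ∑ a, ‖∑ x, (∑ y, f (x, y) * ψ (b * y)) * ψ (a * x)‖ ^ 2 := by
        simp_rw [iterated]
        exact Fintype.sum_prod_type_right _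
    _ = Fintype.card R * ∑ x, ∑ b, ‖∑ y, f (x, y) * ψ (b * y)‖ ^ 2 := by
        simp_rw [fun b => sum_norm_sq_sum_mul_addChar hψ fun x => ∑ y, f (x, y) * ψ (b * y)]
        rw [← Finset.mul_sum, Finset.sum_comm]
    _ = Fintype.card R ^ 2 * ∑ v, ‖f v‖ ^ 2 := by
        simp_rw [sum_norm_sq_sum_mul_addChar hψ fun y => f (_, y)]
        rw [← Finset.mul_sum, Fintype.sum_prod_type, sq, mul_assoc]

end AdditiveCharacters

theorem norm_sq_sub_one_sq_of_norm_eq_one {z : ℂ} (hz : ‖z‖ = 1) :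
    ‖z ^ 2 - 1‖ ^ 2 = 4 * (1 - z.re ^ 2) := by
  have hz2 : z.re * z.re + z.im * z.im = 1 := by
    rw [← Complex.normSq_apply, Complex.normSq_eq_norm_sq, hz, one_pow]
  rw [← Complex.normSq_eq_norm_sq, Complex.normSq_apply]
  simp only [sq, Complex.sub_re, Complex.sub_im, Complex.mul_re, Complex.mul_im, Complex.one_re,
    Complex.one_im]
  linear_combination (z.re * z.re + z.im * z.im + 3) * hz2

section StdAddChar

variable {n : ℕ} [NeZero n]

theorem four_mul_abs_valMinAbs_div_le_norm_stdAddChar_sub_one (a : ZMod n) :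
    4 * |(a.valMinAbs : ℝ)| / n ≤ ‖ZMod.stdAddChar a - 1‖ := by
  have hn : (0 : ℝ) < n := Nat.cast_pos.mpr (NeZero.pos n)
  have hexp : ZMod.stdAddChar a =
      Complex.exp (Complex.I * (2 * (Real.pi * a.valMinAbs / n) : ℝ)) := by
    conv_lhs => rw [← ZMod.coe_valMinAbs a, ZMod.stdAddChar_coe]
    push_cast
    ring_nf
  have habs : |Real.pi * a.valMinAbs / n| = Real.pi * (|(a.valMinAbs : ℝ)| / n) := by
    rw [mul_div_assoc, abs_mul, abs_div, abs_of_pos Real.pi_pos, abs_of_pos hn]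
  have hhalf : |(a.valMinAbs : ℝ)| / n ≤ 1 / 2 := by
    obtain ⟨hlo, hhi⟩ := a.valMinAbs_mem_Ioc
    rw [div_le_div_iff₀ hn two_pos, one_mul, ← abs_two, ← abs_mul, abs_le]
    exact ⟨by exact_mod_cast hlo.le, by exact_mod_cast hhi⟩
  have jordan : 2 / Real.pi * |Real.pi * a.valMinAbs / n| ≤
      |Real.sin (Real.pi * a.valMinAbs / n)| :=
    Real.mul_abs_le_abs_sin (by rw [habs]; nlinarith [Real.pi_pos])
  rw [hexp, Complex.norm_exp_I_mul_ofReal_sub_one, Real.norm_eq_abs, abs_mul, abs_two,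
    mul_div_cancel_left₀ _ two_ne_zero]
  calc 4 * |(a.valMinAbs : ℝ)| / n = 2 * (2 / Real.pi * |Real.pi * a.valMinAbs / n|) := by
        rw [habs]
        field_simp
        ring
    _ ≤ 2 * |Real.sin (Real.pi * a.valMinAbs / n)| := by gcongr

theorem four_div_le_norm_stdAddChar_sub_one {a : ZMod n} (ha : a ≠ 0) :
    4 / (n : ℝ) ≤ ‖ZMod.stdAddChar a - 1‖ := by
  refine le_trans ?_ (four_mul_abs_valMinAbs_div_le_norm_stdAddChar_sub_one a)
  have hone : (1 : ℝ) ≤ |(a.valMinAbs : ℝ)| := by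
    exact_mod_cast Int.one_le_abs (by simpa only [ne_eq, ZMod.valMinAbs_eq_zero] using ha)
  gcongr
  linarith

theorem stdAddChar_one_re : (ZMod.stdAddChar (1 : ZMod n)).re = Real.cos (2 * (Real.pi / n)) := by
  rw [← Int.cast_one, ZMod.stdAddChar_coe, ← Complex.exp_ofReal_mul_I_re]
  congr 2
  push_cast
  ring

theorem hasSum_pow_natAbs {x : ℝ} (h₀ : 0 ≤ x) (h₁ : x < 1) :
    HasSum (fun j : ℤ => x ^ j.natAbs) ((1 + x) / (1 - x)) := by
  have hgeom := hasSum_geometric_of_lt_one h₀ h₁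
  have hneg : HasSum (fun j : ℕ => x ^ (-((j : ℤ) + 1)).natAbs) (x * (1 - x)⁻¹) := by
    refine (hgeom.mul_left x).congr_fun fun j => ?_
    rw [Int.natAbs_neg, ← Nat.cast_succ, Int.natAbs_natCast, pow_succ']
  have hsum := HasSum.of_nat_of_neg_add_one (f := fun j : ℤ => x ^ j.natAbs)
    (by simpa only [Int.natAbs_natCast] using hgeom) hneg
  rwa [← one_add_mul, ← div_eq_mul_inv] at hsum

theorem sum_pow_natAbs_valMinAbs_le {x : ℝ} (h₀ : 0 ≤ x) (h₁ : x ≤ 1 / 2) :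
    ∑ a : ZMod n, x ^ a.valMinAbs.natAbs ≤ 1 + 4 * x := by
  have hsum := hasSum_pow_natAbs h₀ (h₁.trans_lt one_half_lt_one)
  calc ∑ a : ZMod n, x ^ a.valMinAbs.natAbs ≤ (1 + x) / (1 - x) := by
        rw [← hsum.tsum_eq, ← tsum_fintype (L := .unconditional _)]
        exact tsum_comp_le_tsum_of_inj hsum.summable (fun _ => pow_nonneg h₀ _)
          ZMod.injective_valMinAbs
    _ ≤ 1 + 4 * x := by
        rw [div_le_iff₀ (by linarith)]
        nlinarith

theorem sum_exp_neg_mul_norm_stdAddChar_sub_one_sq_le {t : ℝ} (ht : (n : ℝ) ^ 2 ≤ t) :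
    ∑ a : ZMod n, Real.exp (-(t * ‖ZMod.stdAddChar a - 1‖ ^ 2 / 8)) ≤
      1 + 4 * Real.exp (-(2 * t / n ^ 2)) := by
  have hn : (0 : ℝ) < n := Nat.cast_pos.mpr (NeZero.pos n)
  have ht₀ : 0 ≤ t := (sq_nonneg _).trans ht
  have hsmall : Real.exp (-(2 * t / n ^ 2)) ≤ 1 / 2 := by
    have htwo : 1 + 1 ≤ 2 * t / (n : ℝ) ^ 2 + 1 := by
      gcongr
      rw [le_div_iff₀ (by positivity)]
      linarith
    rw [Real.exp_neg, one_div]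
    gcongr
    linarith [Real.add_one_le_exp (2 * t / (n : ℝ) ^ 2)]
  refine (Finset.sum_le_sum fun a _ => ?_).trans
    (sum_pow_natAbs_valMinAbs_le (Real.exp_pos _).le hsmall)
  have hnatAbs : (a.valMinAbs.natAbs : ℝ) ≤ |(a.valMinAbs : ℝ)| ^ 2 := by
    rw [sq_abs, ← Int.cast_natCast, ← Int.cast_pow]
    exact Int.cast_le.mpr (Int.natAbs_le_self_sq _)
  rw [← Real.exp_nat_mul, Real.exp_le_exp, mul_neg, neg_le_neg_iff]
  calc a.valMinAbs.natAbs * (2 * t / n ^ 2) ≤ |(a.valMinAbs : ℝ)| ^ 2 * (2 * t / n ^ 2) := by gcongr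
    _ = t * (4 * |(a.valMinAbs : ℝ)| / n) ^ 2 / 8 := by ring
    _ ≤ t * ‖ZMod.stdAddChar a - 1‖ ^ 2 / 8 := by
        gcongr
        exact four_mul_abs_valMinAbs_div_le_norm_stdAddChar_sub_one a

end StdAddChar

section RandomWalk

variable {H : Type*} [Group H] {S : Finset H} (hS : S.Nonempty)

theorem toReal_walkLaw_succ_apply (k : ℕ) (g : H) :
    (walkLaw S hS (k + 1) g).toReal =
      (S.card : ℝ)⁻¹ * ∑ s ∈ S, (walkLaw S hS k (g * s⁻¹)).toReal := by
  have hmap (s : H) : (walkLaw S hS k).map (· * s) g = walkLaw S hS k (g * s⁻¹) := by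
    classical
    simp only [PMF.map_apply, ← mul_inv_eq_iff_eq_mul (a := g),
      eq_comm (a := g * s⁻¹), tsum_ite_eq]
  have hbind : walkLaw S hS (k + 1) =
      (PMF.uniformOfFinset S hS).bind fun s => (walkLaw S hS k).map (· * s) :=
    PMF.bind_comm _ _ _
  have hsupport (s : H) (hs : s ∉ S) :
      PMF.uniformOfFinset S hS s * walkLaw S hS k (g * s⁻¹) = 0 := by
    rw [PMF.uniformOfFinset_apply_of_notMem _ hs, zero_mul]
  rw [hbind, PMF.bind_apply]
  simp_rw [hmap]
  rw [tsum_eq_sum hsupport, ENNReal.toReal_sum fun s _ =>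
    ENNReal.mul_ne_top (PMF.apply_ne_top _ _) (PMF.apply_ne_top _ _), Finset.mul_sum]
  refine Finset.sum_congr rfl fun s hs => ?_
  rw [PMF.uniformOfFinset_apply_of_mem _ hs, ENNReal.toReal_mul, ENNReal.toReal_inv,
    ENNReal.toReal_natCast]

/-- The Fourier transform turns the convolution power `walkLaw S hS k` into a power. -/
theorem sum_walkLaw_smul_monoidHom [Fintype H] {A : Type*} [Ring A] [Algebra ℝ A] (ρ : H →* A)
    (k : ℕ) :
    ∑ g, (walkLaw S hS k g).toReal • ρ g = ((S.card : ℝ)⁻¹ • ∑ s ∈ S, ρ s) ^ k := by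
  classical
  induction k with
  | zero => simp [walkLaw, PMF.pure_apply, ite_smul, apply_ite ENNReal.toReal]
  | succ k ih =>
    have translate (s : H) : ∑ g, (walkLaw S hS k (g * s⁻¹)).toReal • ρ g =
        (∑ g, (walkLaw S hS k g).toReal • ρ g) * ρ s := by
      rw [← Equiv.sum_comp (Equiv.mulRight s), Finset.sum_mul]
      simp only [Equiv.coe_mulRight, mul_inv_cancel_right, map_mul, smul_mul_assoc]
    calc ∑ g, (walkLaw S hS (k + 1) g).toReal • ρ g
        = (S.card : ℝ)⁻¹ • ∑ s ∈ S, ∑ g, (walkLaw S hS k (g * s⁻¹)).toReal • ρ g := by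
          simp_rw [toReal_walkLaw_succ_apply, mul_smul, ← Finset.smul_sum, Finset.sum_smul]
          rw [Finset.sum_comm]
      _ = ((S.card : ℝ)⁻¹ • ∑ s ∈ S, ρ s) ^ (k + 1) := by
          simp_rw [translate, ih]
          rw [← Finset.mul_sum, pow_succ, mul_smul_comm]

theorem norm_sum_walkLaw_smul_isometry_le [Fintype H] {E : Type*} [NormedAddCommGroup E]
    [NormedSpace ℂ E] (ρ : H →* (E →ₗᵢ[ℂ] E)) {c : ℝ} (hc : 0 ≤ c)
    (h : ∀ f, ‖∑ s ∈ S, ρ s f‖ ≤ S.card * c * ‖f‖) (f : E) (k : ℕ) :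
    ‖∑ g, (walkLaw S hS k g).toReal • ρ g f‖ ≤ c ^ k * ‖f‖ := by
  let T : H →* Module.End ℂ E :=
    { toFun g := (ρ g).toLinearMap
      map_one' := by rw [map_one]; rfl
      map_mul' g h := by rw [map_mul]; rfl }
  have hcard : (0 : ℝ) < S.card := Nat.cast_pos.mpr hS.card_pos
  set A : Module.End ℂ E := (S.card : ℝ)⁻¹ • ∑ s ∈ S, T s with hA
  have contraction (f : E) : ‖A f‖ ≤ c * ‖f‖ := by
    rw [hA, LinearMap.smul_apply, LinearMap.sum_apply, norm_smul, norm_inv, Real.norm_natCast,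
      inv_mul_le_iff₀ hcard, ← mul_assoc]
    exact h f
  have power_contraction (j : ℕ) : ‖(A ^ j) f‖ ≤ c ^ j * ‖f‖ := by
    induction j with
    | zero => rw [pow_zero, pow_zero, Module.End.one_apply, one_mul]
    | succ j ih =>
      rw [pow_succ', Module.End.mul_apply, pow_succ', mul_assoc]
      exact (contraction _).trans (mul_le_mul_of_nonneg_left ih hc)
  have hwalk : ∑ g, (walkLaw S hS k g).toReal • ρ g f = (A ^ k) f := by
    rw [hA, ← sum_walkLaw_smul_monoidHom hS, LinearMap.sum_apply]
    rfl
  exact hwalk ▸ power_contraction k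

end RandomWalk

section TotalVariation

variable {α : Type*} [Fintype α]

theorem sum_toReal_pmf (p : PMF α) : ∑ a, (p a).toReal = 1 := by
  rw [← ENNReal.toReal_sum fun a _ => p.apply_ne_top a, ← tsum_fintype (L := .unconditional _),
    p.tsum_coe, ENNReal.toReal_one]

theorem tvDist_le_one (p q : PMF α) : tvDist p q ≤ 1 := by
  have htriangle : ∑ a, |(p a).toReal - (q a).toReal| ≤ ∑ a, ((p a).toReal + (q a).toReal) :=
    Finset.sum_le_sum fun a _ => (abs_sub _ _).trans_eq <| by
      rw [abs_of_nonneg ENNReal.toReal_nonneg, abs_of_nonneg ENNReal.toReal_nonneg]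
  rw [Finset.sum_add_distrib, sum_toReal_pmf, sum_toReal_pmf] at htriangle
  rw [tvDist]
  linarith

theorem toReal_uniformOfFintype_apply [Nonempty α] (a : α) :
    (PMF.uniformOfFintype α a).toReal = (Fintype.card α : ℝ)⁻¹ := by
  rw [PMF.uniformOfFintype_apply, ENNReal.toReal_inv, ENNReal.toReal_natCast]

theorem four_mul_tvDist_uniformOfFintype_sq_le [Nonempty α] (p : PMF α) :
    4 * tvDist p (PMF.uniformOfFintype α) ^ 2 ≤ Fintype.card α * ∑ a, (p a).toReal ^ 2 - 1 := by
  have hcard : (Fintype.card α : ℝ) ≠ 0 := Nat.cast_ne_zero.mpr Fintype.card_ne_zero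
  have cauchy_schwarz := sq_sum_le_card_mul_sum_sq (s := Finset.univ)
    (f := fun a => |(p a).toReal - (PMF.uniformOfFintype α a).toReal|)
  have hexpand : ∑ a, |(p a).toReal - (PMF.uniformOfFintype α a).toReal| ^ 2 =
      ∑ a, (p a).toReal ^ 2 - (Fintype.card α : ℝ)⁻¹ := by
    simp only [sq_abs, toReal_uniformOfFintype_apply, sub_sq, Finset.sum_add_distrib,
      Finset.sum_sub_distrib, ← Finset.sum_mul, ← Finset.mul_sum, sum_toReal_pmf,
      Finset.sum_const, Finset.card_univ, nsmul_eq_mul]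
    field_simp
    ring
  rw [hexpand, Finset.card_univ, mul_sub, mul_inv_cancel₀ hcard] at cauchy_schwarz
  rw [tvDist]
  linarith

theorem norm_sum_smul_sub_le_two_mul_tvDist {E : Type*} [SeminormedAddCommGroup E]
    [NormedSpace ℝ E] (p q : PMF α) {F : α → E} (hF : ∀ a, ‖F a‖ ≤ 1) :
    ‖∑ a, (p a).toReal • F a - ∑ a, (q a).toReal • F a‖ ≤ 2 * tvDist p q := by
  rw [← Finset.sum_sub_distrib, tvDist, ← mul_assoc, mul_one_div_cancel two_ne_zero, one_mul]
  refine norm_sum_le_of_le _ fun a _ => ?_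
  rw [← sub_smul, norm_smul, Real.norm_eq_abs]
  exact mul_le_of_le_one_right (abs_nonneg _) (hF a)

theorem norm_average_pow_le_two_mul_tvDist {H : Type*} [Group H] [Fintype H] {S : Finset H}
    (hS : S.Nonempty) {χ : H →* ℂ} (hχ : χ ≠ 1) (k : ℕ) :
    ‖(S.card : ℝ)⁻¹ • ∑ s ∈ S, χ s‖ ^ k ≤
      2 * tvDist (walkLaw S hS k) (PMF.uniformOfFintype H) := by
  have hnorm (g : H) : ‖χ g‖ ≤ 1 :=
    (Complex.norm_eq_one_of_pow_eq_one (by rw [← map_pow, pow_card_eq_one, map_one])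
      Fintype.card_ne_zero).le
  have huniform : ∑ g, (PMF.uniformOfFintype H g).toReal • χ g = 0 := by
    simp_rw [toReal_uniformOfFintype_apply, ← Finset.smul_sum, sum_hom_units_eq_zero χ hχ,
      smul_zero]
  have htest := norm_sum_smul_sub_le_two_mul_tvDist (walkLaw S hS k) (PMF.uniformOfFintype H) hnorm
  rwa [huniform, sub_zero, sum_walkLaw_smul_monoidHom, norm_pow] at htest

end TotalVariation

namespace Heisenberg

section Coordinates

variable {R : Type*} [Fintype R]

theorem sum_eq_sum_coordinates {M : Type*} [AddCommMonoid M] (f : Heisenberg R → M) :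
    ∑ g, f g = ∑ v : R × R, ∑ z, f ⟨v.1, v.2, z⟩ := by
  rw [← (equivProd R).symm.sum_comp, Fintype.sum_prod_type, Fintype.sum_prod_type]
  exact Finset.sum_congr rfl fun x _ => Fintype.sum_prod_type _

theorem card_eq : Fintype.card (Heisenberg R) = Fintype.card R ^ 3 := by
  rw [Fintype.card_congr (equivProd R), Fintype.card_prod, Fintype.card_prod]
  ring

end Coordinates

section Fourier

variable {R : Type*} [CommRing R]

/-- The one-dimensional representation of the Heisenberg group that is trivial on the center and
has frequency `u` on the quotient `R × R`. -/
def abelianChar (ψ : AddChar R ℂ) (u : R × R) : Heisenberg R →* ℂ where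
  toFun g := ψ (u.1 * g.x + u.2 * g.y)
  map_one' := by simp only [one_def, mul_zero, add_zero, AddChar.map_zero_eq_one]
  map_mul' g h := by
    rw [← AddChar.map_add_eq_mul]
    congr 1
    simp only [mul_def]
    ring

theorem abelianChar_apply (ψ : AddChar R ℂ) (u : R × R) (g : Heisenberg R) :
    abelianChar ψ u g = ψ (u.1 * g.x + u.2 * g.y) := rfl

variable [Fintype R]

/-- The representation of the Heisenberg group by left translations of those functions on it on
which the center acts through `χ`. Such a function is recorded by its values at `z = 0`. -/
noncomputable def centralRep (χ : AddChar R ℂ) :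
    Heisenberg R →* (EuclideanSpace ℂ (R × R) →ₗᵢ[ℂ] EuclideanSpace ℂ (R × R)) where
  toFun g :=
    { toFun f := WithLp.toLp 2 fun v => χ (g.z + g.x * (v.2 - g.y)) * f (v - (g.x, g.y))
      map_add' f f' := by
        ext v
        exact mul_add _ _ _
      map_smul' c f := by
        ext v
        exact mul_left_comm _ _ _
      norm_map' f := by
        simp only [LinearMap.coe_mk, AddHom.coe_mk, EuclideanSpace.norm_eq, norm_mul,
          AddChar.norm_apply, one_mul]
        congr 1
        exact (Equiv.subRight (g.x, g.y)).sum_comp fun v => ‖f v‖ ^ 2 }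
  map_one' := by
    ext f v
    simp [one_def, Prod.mk_zero_zero]
  map_mul' g h := by
    ext f v
    change _ = _ * (χ (h.z + h.x * (v.2 - g.y - h.y)) * f (v - (g.x, g.y) - (h.x, h.y)))
    rw [← mul_assoc, ← AddChar.map_add_eq_mul, sub_sub v]
    change χ (g.z + h.z + g.x * h.y + (g.x + h.x) * (v.2 - (g.y + h.y))) * _ = _
    congr 2
    ring

theorem centralRep_apply (χ : AddChar R ℂ) (g : Heisenberg R) (f : EuclideanSpace ℂ (R × R))
    (v : R × R) :
    centralRep χ g f v = χ (g.z + g.x * (v.2 - g.y)) * f (v - (g.x, g.y)) := rfl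

theorem centralRep_comm (χ : AddChar R ℂ) (g h : Heisenberg R) (f : EuclideanSpace ℂ (R × R)) :
    centralRep χ g (centralRep χ h f) =
      χ (g.x * h.y - h.x * g.y) • centralRep χ h (centralRep χ g f) := by
  ext v
  simp only [PiLp.smul_apply, smul_eq_mul, centralRep_apply, ← mul_assoc,
    ← AddChar.map_add_eq_mul, Prod.snd_sub, sub_sub, Prod.mk_add_mk]
  congr 2
  · ring
  · rw [add_comm g.x, add_comm g.y]

/-- The Fourier transform of `p` along the center, at the central character `χ`. -/
noncomputable def centralFourier (χ : AddChar R ℂ) (p : Heisenberg R → ℂ) :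
    EuclideanSpace ℂ (R × R) :=
  WithLp.toLp 2 fun v => ∑ z, p ⟨v.1, v.2, z⟩ * χ z

theorem centralFourier_eq_sum [DecidableEq R] (χ : AddChar R ℂ) (p : Heisenberg R → ℂ) :
    centralFourier χ p = ∑ g, p g • centralRep χ g (PiLp.single 2 0 1) := by
  ext v
  simp [centralFourier, sum_eq_sum_coordinates, centralRep_apply, sub_eq_zero]

theorem norm_sq_centralFourier (χ : AddChar R ℂ) (p : Heisenberg R → ℂ) :
    ‖centralFourier χ p‖ ^ 2 = ∑ v : R × R, ‖∑ z, p ⟨v.1, v.2, z⟩ * χ z‖ ^ 2 :=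
  EuclideanSpace.norm_sq_eq _

theorem sum_norm_sq_centralFourier {ψ : AddChar R ℂ} (hψ : ψ.IsPrimitive)
    (p : Heisenberg R → ℂ) :
    ∑ m, ‖centralFourier (ψ.mulShift m) p‖ ^ 2 = Fintype.card R * ∑ g, ‖p g‖ ^ 2 := by
  simp_rw [norm_sq_centralFourier, AddChar.mulShift_apply]
  rw [Finset.sum_comm, sum_eq_sum_coordinates, Finset.mul_sum]
  exact Finset.sum_congr rfl fun v _ => sum_norm_sq_sum_mul_addChar hψ _

theorem sum_norm_sq_sum_mul_abelianChar {ψ : AddChar R ℂ} (hψ : ψ.IsPrimitive)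
    (p : Heisenberg R → ℂ) :
    ∑ u, ‖∑ g, p g * abelianChar ψ u g‖ ^ 2 = Fintype.card R ^ 2 * ‖centralFourier 1 p‖ ^ 2 := by
  simp_rw [norm_sq_centralFourier, AddChar.one_apply, mul_one,
    ← sum_norm_sq_sum_prod_mul_addChar hψ, sum_eq_sum_coordinates, abelianChar_apply,
    Finset.sum_mul]

theorem plancherel [DecidableEq R] {ψ : AddChar R ℂ} (hψ : ψ.IsPrimitive)
    (p : Heisenberg R → ℂ) :
    Fintype.card R ^ 3 * ∑ g, ‖p g‖ ^ 2 = ∑ u, ‖∑ g, p g * abelianChar ψ u g‖ ^ 2 +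
      Fintype.card R ^ 2 * ∑ m ∈ {0}ᶜ, ‖centralFourier (ψ.mulShift m) p‖ ^ 2 := by
  rw [sum_norm_sq_sum_mul_abelianChar hψ, pow_succ, mul_assoc, ← sum_norm_sq_centralFourier hψ,
    ← mul_add, ← AddChar.mulShift_zero ψ, Fintype.sum_eq_add_sum_compl 0]

end Fourier

section LiftedSteps

variable {R : Type*} [CommRing R]

theorem bijective_pair_dotProduct [Finite R] {v w : R × R}
    (hd : IsUnit (v.1 * w.2 - w.1 * v.2)) :
    Function.Bijective fun u : R × R => (u.1 * v.1 + u.2 * v.2, u.1 * w.1 + u.2 * w.2) := by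
  refine Function.Injective.bijective_of_finite fun u u' huu' => ?_
  obtain ⟨hv, hw⟩ := Prod.mk.inj huu'
  exact Prod.ext (hd.mul_left_cancel (by linear_combination w.2 * hv - v.2 * hw))
    (hd.mul_left_cancel (by linear_combination v.1 * hw - w.1 * hv))

variable [DecidableEq R]

/-- A set of lifts to the Heisenberg group of the steps `±v` and `±w` of the quotient `R × R`.
The heights `c₁`, `c₁'`, `c₂`, `c₂'` are arbitrary, so that both `negSteps` and `invSteps` are
of this form. -/
def liftedSteps (v w : R × R) (c₁ c₁' c₂ c₂' : R) : Finset (Heisenberg R) :=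
  {⟨v.1, v.2, c₁⟩, ⟨-v.1, -v.2, c₁'⟩, ⟨w.1, w.2, c₂⟩, ⟨-w.1, -w.2, c₂'⟩}

variable {v w : R × R} {c₁ c₁' c₂ c₂' : R}

theorem sum_liftedSteps (hd : 2 * (v.1 * w.2 - w.1 * v.2) ≠ 0) {M : Type*} [AddCommMonoid M]
    (f : Heisenberg R → M) :
    ∑ s ∈ liftedSteps v w c₁ c₁' c₂ c₂', f s =
      f ⟨v.1, v.2, c₁⟩ + f ⟨-v.1, -v.2, c₁'⟩ + (f ⟨w.1, w.2, c₂⟩ + f ⟨-w.1, -w.2, c₂'⟩) := by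
  have h₁ : (⟨v.1, v.2, c₁⟩ : Heisenberg R) ∉
      ({⟨-v.1, -v.2, c₁'⟩, ⟨w.1, w.2, c₂⟩, ⟨-w.1, -w.2, c₂'⟩} : Finset (Heisenberg R)) := by
    simp only [Finset.mem_insert, Finset.mem_singleton, Heisenberg.mk.injEq, not_or]
    refine ⟨fun ⟨hx, hy, _⟩ => hd ?_, fun ⟨hx, hy, _⟩ => hd ?_, fun ⟨hx, hy, _⟩ => hd ?_⟩
    · linear_combination w.2 * hx - w.1 * hy
    · linear_combination 2 * w.2 * hx - 2 * w.1 * hy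
    · linear_combination 2 * w.2 * hx - 2 * w.1 * hy
  have h₂ : (⟨-v.1, -v.2, c₁'⟩ : Heisenberg R) ∉
      ({⟨w.1, w.2, c₂⟩, ⟨-w.1, -w.2, c₂'⟩} : Finset (Heisenberg R)) := by
    simp only [Finset.mem_insert, Finset.mem_singleton, Heisenberg.mk.injEq, not_or]
    refine ⟨fun ⟨hx, hy, _⟩ => hd ?_, fun ⟨hx, hy, _⟩ => hd ?_⟩
    · linear_combination 2 * w.1 * hy - 2 * w.2 * hx
    · linear_combination 2 * w.1 * hy - 2 * w.2 * hx
  have h₃ : (⟨w.1, w.2, c₂⟩ : Heisenberg R) ∉ ({⟨-w.1, -w.2, c₂'⟩} : Finset (Heisenberg R)) := by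
    simp only [Finset.mem_singleton, Heisenberg.mk.injEq]
    exact fun ⟨hx, hy, _⟩ => hd (by linear_combination v.1 * hy - v.2 * hx)
  rw [liftedSteps, Finset.sum_insert h₁, Finset.sum_insert h₂, Finset.sum_insert h₃,
    Finset.sum_singleton, add_assoc]

theorem card_liftedSteps (hd : 2 * (v.1 * w.2 - w.1 * v.2) ≠ 0) :
    (liftedSteps v w c₁ c₁' c₂ c₂').card = 4 := by
  rw [Finset.card_eq_sum_ones, sum_liftedSteps hd]
  rfl

theorem average_abelianChar_liftedSteps [Finite R] (hd : 2 * (v.1 * w.2 - w.1 * v.2) ≠ 0)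
    (ψ : AddChar R ℂ) (u : R × R) :
    ((liftedSteps v w c₁ c₁' c₂ c₂').card : ℝ)⁻¹ •
        ∑ s ∈ liftedSteps v w c₁ c₁' c₂ c₂', abelianChar ψ u s =
      (((ψ (u.1 * v.1 + u.2 * v.2)).re + (ψ (u.1 * w.1 + u.2 * w.2)).re) / 2 : ℝ) := by
  have hpair (x y : R) : ψ (u.1 * x + u.2 * y) + ψ (u.1 * -x + u.2 * -y) =
      (2 * (ψ (u.1 * x + u.2 * y)).re : ℝ) := by
    rw [← Complex.add_conj, ← AddChar.map_neg_eq_conj, neg_add, mul_neg, mul_neg]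
  rw [card_liftedSteps hd, sum_liftedSteps hd]
  simp only [abelianChar_apply, hpair, Complex.real_smul]
  push_cast
  ring

theorem norm_average_abelianChar_liftedSteps_sq_le [Finite R]
    (hd : 2 * (v.1 * w.2 - w.1 * v.2) ≠ 0) (ψ : AddChar R ℂ) (u : R × R) :
    ‖((liftedSteps v w c₁ c₁' c₂ c₂').card : ℝ)⁻¹ •
        ∑ s ∈ liftedSteps v w c₁ c₁' c₂ c₂', abelianChar ψ u s‖ ^ 2 ≤
      Real.exp (-(‖ψ (2 * (u.1 * v.1 + u.2 * v.2)) - 1‖ ^ 2 / 8)) *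
        Real.exp (-(‖ψ (2 * (u.1 * w.1 + u.2 * w.2)) - 1‖ ^ 2 / 8)) := by
  have hdouble (a : R) : ‖ψ (2 * a) - 1‖ ^ 2 = 4 * (1 - (ψ a).re ^ 2) := by
    rw [two_mul, AddChar.map_add_eq_mul, ← sq, norm_sq_sub_one_sq_of_norm_eq_one (ψ.norm_apply a)]
  rw [average_abelianChar_liftedSteps hd, Complex.norm_real, Real.norm_eq_abs, sq_abs, hdouble,
    hdouble, ← Real.exp_add]
  refine le_trans ?_ (Real.add_one_le_exp _)
  linarith [add_sq_le (a := (ψ (u.1 * v.1 + u.2 * v.2)).re)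
    (b := (ψ (u.1 * w.1 + u.2 * w.2)).re)]

theorem norm_sum_centralRep_liftedSteps_le [Fintype R]
    (hd : 2 * (v.1 * w.2 - w.1 * v.2) ≠ 0) (χ : AddChar R ℂ) (f : EuclideanSpace ℂ (R × R)) :
    ‖∑ s ∈ liftedSteps v w c₁ c₁' c₂ c₂', centralRep χ s f‖ ≤
      (4 - ‖χ (4 * (v.1 * w.2 - w.1 * v.2)) - 1‖ / 12) * ‖f‖ := by
  have hdivide (s s' : Heisenberg R) :
      centralRep χ s f = centralRep χ s' (centralRep χ (s'⁻¹ * s) f) := by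
    rw [← Function.comp_apply (f := centralRep χ s'), ← LinearIsometry.coe_mul, ← map_mul,
      mul_inv_cancel_left]
  rw [sum_liftedSteps hd]
  refine norm_sum_isometries_le _ _ _ _ _ _ (χ.norm_apply _)
    (hdivide _ ⟨-v.1, -v.2, c₁'⟩) (hdivide _ ⟨-w.1, -w.2, c₂'⟩) ?_
  rw [centralRep_comm]
  congr 2
  simp only [mul_def, inv_def]
  ring

theorem norm_centralFourier_walkLaw_le [Fintype R] (hd : 2 * (v.1 * w.2 - w.1 * v.2) ≠ 0)
    (χ : AddChar R ℂ) (hS : (liftedSteps v w c₁ c₁' c₂ c₂').Nonempty) (k : ℕ) :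
    ‖centralFourier χ fun g => ((walkLaw _ hS k g).toReal : ℂ)‖ ≤
      (1 - ‖χ (4 * (v.1 * w.2 - w.1 * v.2)) - 1‖ / 48) ^ k := by
  have hnorm := norm_sub_one_le_two (χ.norm_apply (4 * (v.1 * w.2 - w.1 * v.2)))
  have hwalk := norm_sum_walkLaw_smul_isometry_le hS (centralRep χ)
    (c := 1 - ‖χ (4 * (v.1 * w.2 - w.1 * v.2)) - 1‖ / 48) (by linarith) (fun f => by
      rw [card_liftedSteps hd]
      refine (norm_sum_centralRep_liftedSteps_le hd χ f).trans_eq ?_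
      push_cast
      ring) (PiLp.single 2 0 1) k
  rw [PiLp.norm_single, norm_one, mul_one] at hwalk
  simpa only [centralFourier_eq_sum, Complex.coe_smul] using hwalk

end LiftedSteps

section ModN

variable {n : ℕ} [NeZero n] [Nontrivial (ZMod n)] {v w : ZMod n × ZMod n}
  {c₁ c₁' c₂ c₂' : ZMod n} (h2 : IsUnit (2 : ZMod n)) (hd : IsUnit (v.1 * w.2 - w.1 * v.2))
  (hS : (liftedSteps v w c₁ c₁' c₂ c₂').Nonempty) (k : ℕ)

include h2 in
theorem three_le_of_isUnit_two : 3 ≤ n := by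
  have hone := ZMod.nontrivial_iff.mp ‹Nontrivial (ZMod n)›
  have hodd : Odd n := Nat.coprime_two_left.mp ((ZMod.isUnit_iff_coprime 2 n).mp h2)
  have htwo : n ≠ 2 := fun h => absurd (h ▸ hodd) (by decide)
  have hzero := NeZero.ne n
  omega

include h2 hd

theorem sum_norm_sq_sum_mul_abelianChar_walkLaw_le (hk : n ^ 2 ≤ k) :
    ∑ u, ‖∑ g, ((walkLaw _ hS k g).toReal : ℂ) * abelianChar ZMod.stdAddChar u g‖ ^ 2 ≤
      (1 + 4 * Real.exp (-(2 * k / n ^ 2))) ^ 2 := by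
  let F (a : ZMod n) : ℝ := Real.exp (-(k * ‖ZMod.stdAddChar a - 1‖ ^ 2 / 8))
  have hpow (a : ZMod n) : Real.exp (-(‖ZMod.stdAddChar a - 1‖ ^ 2 / 8)) ^ k = F a := by
    rw [← Real.exp_nat_mul]
    congr 1
    ring
  have hdouble : ∑ a : ZMod n, F (2 * a) = ∑ a, F a :=
    Equiv.sum_comp (Units.mulLeft h2.unit) F
  calc ∑ u, ‖∑ g, ((walkLaw _ hS k g).toReal : ℂ) * abelianChar ZMod.stdAddChar u g‖ ^ 2
      ≤ ∑ u : ZMod n × ZMod n,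
          F (2 * (u.1 * v.1 + u.2 * v.2)) * F (2 * (u.1 * w.1 + u.2 * w.2)) := by
        refine Finset.sum_le_sum fun u _ => ?_
        simp_rw [← Complex.real_smul]
        rw [sum_walkLaw_smul_monoidHom, norm_pow, pow_right_comm, ← hpow, ← hpow, ← mul_pow]
        exact pow_le_pow_left₀ (sq_nonneg _)
          (norm_average_abelianChar_liftedSteps_sq_le (h2.mul hd).ne_zero _ u) k
    _ = ∑ a : ZMod n × ZMod n, F (2 * a.1) * F (2 * a.2) :=
        (bijective_pair_dotProduct hd).sum_comp fun a => F (2 * a.1) * F (2 * a.2)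
    _ = (∑ a, F a) ^ 2 := by rw [Fintype.sum_prod_type, ← hdouble, sq, Finset.sum_mul_sum]
    _ ≤ (1 + 4 * Real.exp (-(2 * k / n ^ 2))) ^ 2 := by
        refine pow_le_pow_left₀ (Finset.sum_nonneg fun _ _ => (Real.exp_pos _).le) ?_ 2
        exact sum_exp_neg_mul_norm_stdAddChar_sub_one_sq_le (by exact_mod_cast hk)

theorem norm_centralFourier_walkLaw_sq_le {m : ZMod n} (hm : m ≠ 0) :
    ‖centralFourier (ZMod.stdAddChar.mulShift m)
        fun g => ((walkLaw _ hS k g).toReal : ℂ)‖ ^ 2 ≤ Real.exp (-(k / (6 * n))) := by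
  have hfreq : m * (4 * (v.1 * w.2 - w.1 * v.2)) ≠ 0 := by
    have hunit : IsUnit (4 * (v.1 * w.2 - w.1 * v.2)) := by
      convert (h2.mul h2).mul hd using 2
      norm_num
    rwa [Ne, hunit.mul_left_eq_zero]
  have hdecay : ‖centralFourier (ZMod.stdAddChar.mulShift m)
      fun g => ((walkLaw _ hS k g).toReal : ℂ)‖ ≤ Real.exp (-(1 / (12 * n))) ^ k := by
    refine (norm_centralFourier_walkLaw_le (h2.mul hd).ne_zero _ hS k).trans ?_
    rw [AddChar.mulShift_apply]
    have hgap := four_div_le_norm_stdAddChar_sub_one hfreq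
    have hnorm := norm_sub_one_le_two
      (ZMod.stdAddChar.norm_apply (m * (4 * (v.1 * w.2 - w.1 * v.2))))
    refine pow_le_pow_left₀ (by linarith) ?_ k
    calc 1 - ‖ZMod.stdAddChar (m * (4 * (v.1 * w.2 - w.1 * v.2))) - 1‖ / 48
        ≤ 1 - 4 / n / 48 := by gcongr
      _ = 1 - 1 / (12 * n) := by ring
      _ ≤ Real.exp (-(1 / (12 * n))) := Real.one_sub_le_exp_neg _
  calc _ ≤ (Real.exp (-(1 / (12 * n))) ^ k) ^ 2 := pow_le_pow_left₀ (norm_nonneg _) hdecay 2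
    _ = Real.exp (-(k / (6 * n))) := by
      rw [← pow_mul, ← Real.exp_nat_mul]
      congr 1
      push_cast
      ring

theorem card_mul_sum_walkLaw_sq_le (hk : n ^ 2 ≤ k) :
    (n : ℝ) ^ 3 * ∑ g, (walkLaw _ hS k g).toReal ^ 2 ≤
      (1 + 4 * Real.exp (-(2 * k / n ^ 2))) ^ 2 + n ^ 3 * Real.exp (-(k / (6 * n))) := by
  have hplancherel := plancherel (ZMod.isPrimitive_stdAddChar n)
    fun g => ((walkLaw _ hS k g).toReal : ℂ)
  simp_rw [Complex.norm_real, Real.norm_eq_abs, sq_abs, ZMod.card] at hplancherel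
  have hcentral : ∑ m ∈ {0}ᶜ, ‖centralFourier (ZMod.stdAddChar.mulShift m)
      fun g => ((walkLaw _ hS k g).toReal : ℂ)‖ ^ 2 ≤ n * Real.exp (-(k / (6 * n))) := by
    calc _ ≤ ∑ m ∈ ({0}ᶜ : Finset (ZMod n)), Real.exp (-(k / (6 * n))) :=
          Finset.sum_le_sum fun m hm => norm_centralFourier_walkLaw_sq_le h2 hd hS k (by
            simpa only [Finset.mem_compl, Finset.mem_singleton] using hm)
      _ ≤ ∑ m : ZMod n, Real.exp (-(k / (6 * n))) :=
          Finset.sum_le_sum_of_subset_of_nonneg (Finset.subset_univ _) fun _ _ _ =>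
            (Real.exp_pos _).le
      _ = n * Real.exp (-(k / (6 * n))) := by
          rw [Finset.sum_const, Finset.card_univ, ZMod.card, nsmul_eq_mul]
  rw [hplancherel]
  calc _ ≤ (1 + 4 * Real.exp (-(2 * k / n ^ 2))) ^ 2 + n ^ 2 * (n * Real.exp (-(k / (6 * n)))) := by
        gcongr
        exact sum_norm_sq_sum_mul_abelianChar_walkLaw_le h2 hd hS k hk
    _ = _ := by ring

theorem tvDist_walkLaw_le :
    tvDist (walkLaw _ hS k) (PMF.uniformOfFintype (Heisenberg (ZMod n))) ≤
      100 * Real.exp (-(k / (24 * n ^ 2))) := by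
  have hn : (0 : ℝ) < n := Nat.cast_pos.mpr (NeZero.pos n)
  rcases lt_or_ge k (n ^ 2) with hk | hk
  · have hshort : (k : ℝ) / (24 * n ^ 2) ≤ 1 / 24 := by
      rw [div_le_div_iff₀ (by positivity) (by positivity)]
      have hk' : (k : ℝ) ≤ n ^ 2 := by exact_mod_cast hk.le
      linarith
    linarith [tvDist_le_one (walkLaw _ hS k) (PMF.uniformOfFintype (Heisenberg (ZMod n))),
      Real.one_sub_le_exp_neg ((k : ℝ) / (24 * n ^ 2))]
  · have hl2 := four_mul_tvDist_uniformOfFintype_sq_le (walkLaw _ hS k)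
    rw [card_eq, ZMod.card, Nat.cast_pow] at hl2
    have hcollision := card_mul_sum_walkLaw_sq_le h2 hd hS k hk
    have hcentral := pow_three_mul_exp_neg_le (Nat.one_le_cast.mpr (NeZero.one_le (n := n)))
      (k := (k : ℝ)) (by exact_mod_cast hk)
    have habelian : Real.exp (-(2 * k / n ^ 2)) ≤ Real.exp (-(k / (12 * n ^ 2))) := by
      rw [Real.exp_le_exp, neg_le_neg_iff, div_le_div_iff₀ (by positivity) (by positivity)]
      have hnonneg : (0 : ℝ) ≤ k * n ^ 2 := by positivity
      linarith
    have hle_one : Real.exp (-(2 * k / (n : ℝ) ^ 2)) ≤ 1 :=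
      Real.exp_le_one_iff.mpr (neg_nonpos.mpr (by positivity))
    have hsquare : Real.exp (-(k / (12 * n ^ 2))) = Real.exp (-(k / (24 * n ^ 2))) ^ 2 := by
      rw [← Real.exp_nat_mul]
      congr 1
      push_cast
      ring
    refine le_of_sq_le_sq ?_ (by positivity)
    rw [mul_pow, ← hsquare]
    nlinarith [Real.exp_pos (-(2 * k / (n : ℝ) ^ 2)), Real.exp_pos (-(k / (12 * (n : ℝ) ^ 2)))]

theorem exp_le_two_mul_tvDist_walkLaw :
    Real.exp (-(4 * Real.pi ^ 2 * k / n ^ 2)) ≤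
      2 * tvDist (walkLaw _ hS k) (PMF.uniformOfFintype (Heisenberg (ZMod n))) := by
  obtain ⟨u, hu⟩ := (bijective_pair_dotProduct hd).surjective (0, 1)
  obtain ⟨huv, huw⟩ := Prod.mk.inj hu
  have hnontrivial : abelianChar (ZMod.stdAddChar (N := n)) u ≠ 1 := fun htrivial => by
    have hone := DFunLike.congr_fun htrivial ⟨w.1, w.2, 0⟩
    rw [abelianChar_apply, huw, MonoidHom.one_apply,
      ← AddChar.map_zero_eq_one (ZMod.stdAddChar (N := n))] at hone
    exact one_ne_zero (ZMod.injective_stdAddChar hone)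
  have haverage := average_abelianChar_liftedSteps (c₁ := c₁) (c₁' := c₁') (c₂ := c₂) (c₂' := c₂')
    (h2.mul hd).ne_zero ZMod.stdAddChar u
  have hcos : ((ZMod.stdAddChar (0 : ZMod n)).re + (ZMod.stdAddChar (1 : ZMod n)).re) / 2 =
      Real.cos (Real.pi / n) ^ 2 := by
    rw [stdAddChar_one_re, Real.cos_two_mul, AddChar.map_zero_eq_one, Complex.one_re]
    ring
  refine le_trans ?_ (norm_average_pow_le_two_mul_tvDist hS hnontrivial k)
  rw [haverage, huv, huw, hcos, Complex.norm_real, Real.norm_of_nonneg (sq_nonneg _)]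
  calc Real.exp (-(4 * Real.pi ^ 2 * k / n ^ 2))
      = (Real.exp (-(2 * (Real.pi / n) ^ 2)) ^ 2) ^ k := by
        rw [← pow_mul, ← Real.exp_nat_mul]
        congr 1
        push_cast
        ring
    _ ≤ (Real.cos (Real.pi / n) ^ 2) ^ k := by
        gcongr
        refine exp_neg_two_mul_sq_le_cos ?_
        have hn : (3 : ℝ) ≤ n := by exact_mod_cast three_le_of_isUnit_two h2
        rw [div_pow, div_le_div_iff₀ (by positivity) two_pos]
        nlinarith [Real.pi_pos, Real.pi_lt_d2]

end ModN

end Heisenberg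

theorem mainTheorem2_general :
    ∃ a b B : ℝ, 0 < a ∧ 0 < b ∧ 0 < B ∧
      ∀ (n : ℕ) [NeZero n], Odd n → n ≠ 1 →
      ∀ v w : ZMod n × ZMod n, IsUnit (v.1 * w.2 - w.1 * v.2) →
      ∀ (c₁ c₁' c₂ c₂' : ZMod n) (hS : (Heisenberg.liftedSteps v w c₁ c₁' c₂ c₂').Nonempty)
        (k : ℕ),
        (1 / 2) * Real.exp (-a * k / n ^ 2)
            ≤ tvDist (walkLaw _ hS k) (PMF.uniformOfFintype (Heisenberg (ZMod n))) ∧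
        tvDist (walkLaw _ hS k) (PMF.uniformOfFintype (Heisenberg (ZMod n)))
            ≤ B * Real.exp (-b * k / n ^ 2) := by
  refine ⟨4 * Real.pi ^ 2, 1 / 24, 100, by positivity, by norm_num, by norm_num,
    fun n _ hodd hone v w hd c₁ c₁' c₂ c₂' hS k => ?_⟩
  have h2 : IsUnit (2 : ZMod n) := (ZMod.isUnit_iff_coprime 2 n).mpr (Nat.coprime_two_left.mpr hodd)
  have : Nontrivial (ZMod n) := ZMod.nontrivial_iff.mpr hone
  constructor
  · have hlower := Heisenberg.exp_le_two_mul_tvDist_walkLaw h2 hd hS k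
    rw [neg_mul, neg_div]
    linarith
  · convert Heisenberg.tvDist_walkLaw_le h2 hd hS k using 3
    ring

theorem mainTheorem2 :
    ∃ a b B : ℝ, 0 < a ∧ 0 < b ∧ 0 < B ∧
      ∀ (n : ℕ) [Fact n.Prime], n ≠ 2 →
      ∀ r₁ s₁ r₂ s₂ : ZMod n, r₁ * s₂ ≠ r₂ * s₁ →
      ∀ (S : Finset (Heisenberg (ZMod n))) (hS : S.Nonempty),
        (S = Heisenberg.negSteps r₁ s₁ r₂ s₂ ∨ S = Heisenberg.invSteps r₁ s₁ r₂ s₂) →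
      ∀ k : ℕ,
        (1 / 2) * Real.exp (-a * k / n ^ 2)
            ≤ tvDist (walkLaw S hS k) (PMF.uniformOfFintype (Heisenberg (ZMod n))) ∧
        tvDist (walkLaw S hS k) (PMF.uniformOfFintype (Heisenberg (ZMod n)))
            ≤ B * Real.exp (-b * k / n ^ 2) := by
  obtain ⟨a, b, B, ha, hb, hB, hbounds⟩ := mainTheorem2_general
  refine ⟨a, b, B, ha, hb, hB, fun n hp hn r₁ s₁ r₂ s₂ hne S hS hsteps k => ?_⟩
  have hodd : Odd n := hp.out.odd_of_ne_two hn
  have hd : IsUnit (s₁ * r₂ - s₂ * r₁) := isUnit_iff_ne_zero.mpr fun h =>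
    hne (by linear_combination -h)
  rcases hsteps with rfl | rfl
  · exact hbounds n hodd hp.out.ne_one (s₁, r₁) (s₂, r₂) hd 0 0 0 0 hS k
  · exact hbounds n hodd hp.out.ne_one (s₁, r₁) (s₂, r₂) hd 0 (-0 + s₁ * r₁) 0 (-0 + s₂ * r₂) hS k
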